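/- Let $n\ge 2$ and let $H$ be a $3$-uniform hypergraph on $[n]=\{1,\dots,n\}$ such that every $4$-element subset of $[n]$ contains an edge of $H$. Then the exterior shifting $H^{<_L}$ of $H$ with respect to the lexicographic order satisfies $$|\{F\in H^{<_L}:\ 1\in F\}|\ \ge\ \binom{n-2}{2}.$$ (With the convention $\binom{m}{2}=0$ for $m<2$ this also holds for $n=0,1$, where $H$ is empty.) Here $X=(x_{i,j})$ is the $n\times n$ matrix of independent variables over $\mathbb{Q}$, and $C_k(X)=(c_{S,T})$ is its $k$-th compound matrix over $\mathbb{Q}(x_{i,j})$, indexed by the $k$-subsets of $[n]$, where $c_{S,T}=\det(x_{i,j})_{i\in S,\,j\in T}$. A family $E_1$ of $k$-subsets of $[n]$ dominates a family $E_2$ of $k$-subsets of $[n]$ if the submatrix of $C_k(X)$ with rows indexed by $E_2$ and columns indexed by $E_1$ has rank $|E_2|$; the families $E_1,E_2$ are weakly isomorphic if each dominates the other. The lexicographic order on $k$-subsets is given by $S<_L T$ if and only if $\min(S\,\triangle\,T)\in S$. For two distinct families $Y,Z$ of $k$-subsets of the same size, $Y$ is $<_L$-smaller than $Z$ if the $<_L$-least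 element of $Y\,\triangle\,Z$ belongs to $Y$. The exterior shifting $\mathcal{F}^{<_L}$ of a family $\mathcal{F}$ of $k$-subsets of $[n]$ is the $<_L$-smallest family of $k$-subsets of $[n]$ of size $|\mathcal{F}|$ that is weakly isomorphic to $\mathcal{F}$. -/

import Mathlib

/-! The ground set `[n]` is modelled by `Fin n`, the vertex `1` being the element of
`Fin n` whose value is `0`. The type `Set.powersetCard (Fin n) k` is the type of `k`-element subsets
of `[n]`, and a `k`-uniform hypergraph on `[n]` is a finite set of such subsets. -/

/-- `Y` precedes `Z` with respect to a strict total order `r` if the `r`-least element of the symmetric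
difference of `Y` and `Z` exists and belongs to `Y`. -/
def Precedes {β : Type*} (r : β → β → Prop) (Y Z : Finset β) : Prop :=
  ∃ a, a ∈ Y ∧ a ∉ Z ∧ ∀ b, (b ∈ Y ∧ b ∉ Z) ∨ (b ∈ Z ∧ b ∉ Y) → b = a ∨ r a b

/-- The lexicographic order on `k`-subsets of `[n]`: `S <_L T` iff `min (S ∆ T) ∈ S`. -/
def LexLT {n k : ℕ} (S T : Set.powersetCard (Fin n) k) : Prop :=
  Precedes (fun i j : Fin n => i < j) (S : Finset (Fin n)) (T : Finset (Fin n))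

/-- The `k`-th compound matrix: the `(S, T)` entry is the minor of `A` with rows `S` and columns `T`. -/
def compound {n : ℕ} {K : Type*} [CommRing K] (k : ℕ) (A : Matrix (Fin n) (Fin n) K) :
    Matrix (Set.powersetCard (Fin n) k) (Set.powersetCard (Fin n) k) K :=
  Matrix.of fun S T =>
    (A.submatrix ((S : Finset (Fin n)).orderEmbOfFin (Set.powersetCard.card_eq S))
      ((T : Finset (Fin n)).orderEmbOfFin (Set.powersetCard.card_eq T))).det

/-- The submatrix of the compound matrix of `A` with rows indexed by `E₂` and columns by `E₁`. -/
def compoundSub {n k : ℕ} {K : Type*} [CommRing K] (A : Matrix (Fin n) (Fin n) K)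
    (E₁ E₂ : Finset (Set.powersetCard (Fin n) k)) :
    Matrix {S // S ∈ E₂} {T // T ∈ E₁} K :=
  (compound k A).submatrix (fun S => S.1) (fun T => T.1)

/-- `E₁` dominates `E₂` with respect to `A`. -/
def Dominates {n k : ℕ} {K : Type*} [CommRing K] (A : Matrix (Fin n) (Fin n) K)
    (E₁ E₂ : Finset (Set.powersetCard (Fin n) k)) : Prop :=
  (compoundSub A E₁ E₂).rank = E₂.card

/-- Weak isomorphism with respect to `A`: each family dominates the other. -/
def WeaklyIsomorphic {n k : ℕ} {K : Type*} [CommRing K] (A : Matrix (Fin n) (Fin n) K)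
    (E₁ E₂ : Finset (Set.powersetCard (Fin n) k)) : Prop :=
  Dominates A E₁ E₂ ∧ Dominates A E₂ E₁

/-- `G` is the exterior shifting of `F` with respect to the order `lt` on `k`-subsets and the matrix `A`:
the smallest among the families of size `|F|` that are weakly isomorphic to `F`. -/
def IsExteriorShifting {n k : ℕ} {K : Type*} [CommRing K]
    (lt : Set.powersetCard (Fin n) k → Set.powersetCard (Fin n) k → Prop)
    (A : Matrix (Fin n) (Fin n) K) (F G : Finset (Set.powersetCard (Fin n) k)) : Prop :=
  (G.card = F.card ∧ WeaklyIsomorphic A G F) ∧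
    ∀ G' : Finset (Set.powersetCard (Fin n) k),
      G'.card = F.card → WeaklyIsomorphic A G' F → G' ≠ G → Precedes lt G G'

/-- The generic matrix `X = (x_{i,j})` over the field `ℚ(x_{i,j})` of rational functions. -/
noncomputable def genericMatrix (n : ℕ) :
    Matrix (Fin n) (Fin n) (FractionRing (MvPolynomial (Fin n × Fin n) ℚ)) :=
  Matrix.of fun i j => algebraMap (MvPolynomial (Fin n × Fin n) ℚ) _ (MvPolynomial.X (i, j))

theorem Precedes.irrefl {β : Type*} {r : β → β → Prop} (Y : Finset β) : ¬ Precedes r Y Y := by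
  rintro ⟨a, h1, h2, -⟩
  exact h2 h1

theorem Precedes.trans {β : Type*} {r : β → β → Prop} (htri : ∀ a b, r a b ∨ a = b ∨ r b a)
    (hirr : ∀ a, ¬ r a a) (htr : ∀ a b c, r a b → r b c → r a c) {Y Z W : Finset β}
    (h1 : Precedes r Y Z) (h2 : Precedes r Z W) : Precedes r Y W := by
  obtain ⟨a, haY, haZ, ha⟩ := h1
  obtain ⟨c, hcZ, hcW, hc⟩ := h2
  have hne : a ≠ c := fun h => haZ (h ▸ hcZ)
  rcases htri a c with h | h | h
  · refine ⟨a, haY, ?_, ?_⟩ <;> grind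
  · exact absurd h hne
  · refine ⟨c, ?_, hcW, ?_⟩ <;> grind

theorem Precedes.total {β : Type*} [Finite β] {r : β → β → Prop}
    (htri : ∀ a b, r a b ∨ a = b ∨ r b a)
    (hirr : ∀ a, ¬ r a a) (htr : ∀ a b c, r a b → r b c → r a c) (Y Z : Finset β) :
    Precedes r Y Z ∨ Y = Z ∨ Precedes r Z Y := by
  by_cases hYZ : Y = Z
  · exact Or.inr (Or.inl hYZ)
  have : Std.Irrefl r := ⟨hirr⟩
  have : IsTrans β r := ⟨htr⟩
  have hwf : WellFounded r := Finite.wellFounded_of_trans_of_irrefl r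
  have hne : {b | (b ∈ Y ∧ b ∉ Z) ∨ (b ∈ Z ∧ b ∉ Y)}.Nonempty := by
    by_contra hcon
    apply hYZ
    ext b
    have hb : b ∉ {b | (b ∈ Y ∧ b ∉ Z) ∨ (b ∈ Z ∧ b ∉ Y)} := fun hb => hcon ⟨b, hb⟩
    simp only [Set.mem_ofPred_eq] at hb
    tauto
  obtain ⟨a, ha, hmin⟩ := hwf.has_min _ hne
  have key : ∀ b, (b ∈ Y ∧ b ∉ Z) ∨ (b ∈ Z ∧ b ∉ Y) → b = a ∨ r a b := by
    intro b hb
    rcases htri a b with h | h | h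
    · exact Or.inr h
    · exact Or.inl h.symm
    · exact absurd h (hmin b hb)
  rcases ha with ha | ha
  · exact Or.inl ⟨a, ha.1, ha.2, key⟩
  · exact Or.inr (Or.inr ⟨a, ha.1, ha.2, fun b hb => key b hb.symm⟩)

theorem LexLT.irrefl {n k : ℕ} (S : Set.powersetCard (Fin n) k) : ¬ LexLT S S :=
  Precedes.irrefl _

theorem LexLT.trans {n k : ℕ} (S T U : Set.powersetCard (Fin n) k) (h1 : LexLT S T)
    (h2 : LexLT T U) : LexLT S U :=
  Precedes.trans lt_trichotomy (fun a => lt_irrefl a) (fun _ _ _ => lt_trans) h1 h2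

theorem LexLT.total {n k : ℕ} (S T : Set.powersetCard (Fin n) k) :
    LexLT S T ∨ S = T ∨ LexLT T S := by
  rcases Precedes.total (r := fun i j : Fin n => i < j) lt_trichotomy (fun a => lt_irrefl a)
    (fun _ _ _ => lt_trans) (S : Finset (Fin n)) (T : Finset (Fin n)) with h | h | h
  · exact Or.inl h
  · exact Or.inr (Or.inl (Subtype.ext h))
  · exact Or.inr (Or.inr h)

theorem compound_map {n : ℕ} {K L : Type*} [CommRing K] [CommRing L] (f : K →+* L) (k : ℕ)
    (A : Matrix (Fin n) (Fin n) K) : compound k (A.map f) = (compound k A).map f := by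
  ext S T
  simp only [compound, Matrix.of_apply, Matrix.map_apply, RingHom.map_det]
  rfl

theorem compound_one_apply {n k : ℕ} {K : Type*} [CommRing K]
    (S T : Set.powersetCard (Fin n) k) (h : S ≠ T) :
    compound k (1 : Matrix (Fin n) (Fin n) K) S T = 0 := by
  have hsub : ¬ (S : Finset (Fin n)) ⊆ (T : Finset (Fin n)) := fun hs =>
    h (Subtype.ext (Finset.eq_of_subset_of_card_le hs (by rw [S.2, T.2])))
  obtain ⟨a, haS, haT⟩ := Finset.not_subset.mp hsub
  have hr : a ∈ Set.range ((S : Finset (Fin n)).orderEmbOfFin (Set.powersetCard.card_eq S)) := by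
    rw [Finset.range_orderEmbOfFin]; exact haS
  obtain ⟨i, hi⟩ := hr
  refine Matrix.det_eq_zero_of_row_eq_zero i fun j => ?_
  rw [Matrix.submatrix_apply, hi, Matrix.one_apply_ne]
  rintro rfl
  exact haT (Finset.orderEmbOfFin_mem _ _ j)

theorem compound_one_self {n k : ℕ} {K : Type*} [CommRing K]
    (S : Set.powersetCard (Fin n) k) :
    compound k (1 : Matrix (Fin n) (Fin n) K) S S = 1 := by
  simp only [compound, Matrix.of_apply]
  rw [Matrix.submatrix_one _ (RelEmbedding.injective _), Matrix.det_one]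

theorem dominates_generic_self {n k : ℕ} (F : Finset (Set.powersetCard (Fin n) k)) :
    Dominates (genericMatrix n) F F := by
  classical
  set P : Matrix (Fin n) (Fin n) (MvPolynomial (Fin n × Fin n) ℚ) :=
    Matrix.of fun i j => MvPolynomial.X (i, j) with hP
  set e : MvPolynomial (Fin n × Fin n) ℚ →+* ℚ :=
    MvPolynomial.eval (fun p => (1 : Matrix (Fin n) (Fin n) ℚ) p.1 p.2) with he
  have h1 : P.map e = 1 := by
    ext i j
    simp [hP, he]
  have h2 : (compoundSub P F F).map e = 1 := by
    ext S T
    have := congrFun (congrFun (compound_map e k P) S.1) T.1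
    rw [h1] at this
    simp only [compoundSub, Matrix.map_apply, Matrix.submatrix_apply] at this ⊢
    rw [← this]
    by_cases hST : S = T
    · subst hST
      rw [compound_one_self, Matrix.one_apply_eq]
    · rw [Matrix.one_apply_ne hST, compound_one_apply]
      exact fun h => hST (Subtype.ext h)
  have h3 : (compoundSub P F F).det ≠ 0 := by
    intro h0
    have := RingHom.map_det e (compoundSub P F F)
    rw [h0, map_zero, RingHom.mapMatrix_apply, h2, Matrix.det_one] at this
    exact zero_ne_one this
  set a := algebraMap (MvPolynomial (Fin n × Fin n) ℚ)
    (FractionRing (MvPolynomial (Fin n × Fin n) ℚ)) with ha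
  have h4 : compoundSub (genericMatrix n) F F = (compoundSub P F F).map a := by
    have hg : genericMatrix n = P.map a := rfl
    rw [hg]
    unfold compoundSub
    rw [compound_map]
    rfl
  have h5 : IsUnit (compoundSub (genericMatrix n) F F) := by
    rw [Matrix.isUnit_iff_isUnit_det, h4, ← RingHom.mapMatrix_apply, ← RingHom.map_det,
      isUnit_iff_ne_zero]
    intro h
    exact h3 ((IsFractionRing.injective (MvPolynomial (Fin n × Fin n) ℚ)
      (FractionRing (MvPolynomial (Fin n × Fin n) ℚ))) (by rw [map_zero]; exact h))
  unfold Dominates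
  rw [Matrix.rank_of_isUnit _ h5, Fintype.card_coe]

/-- The exterior shifting with respect to the lexicographic order exists and is unique. -/
theorem existsUnique_lexShifting {n k : ℕ} (F : Finset (Set.powersetCard (Fin n) k)) :
    ∃! G, IsExteriorShifting LexLT (genericMatrix n) F G := by
  have htr : ∀ Y Z W : Finset (Set.powersetCard (Fin n) k),
      Precedes LexLT Y Z → Precedes LexLT Z W → Precedes LexLT Y W := fun _ _ _ =>
    Precedes.trans LexLT.total LexLT.irrefl LexLT.trans
  have : Std.Irrefl (Precedes (LexLT (n := n) (k := k))) := ⟨Precedes.irrefl⟩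
  have : IsTrans _ (Precedes (LexLT (n := n) (k := k))) := ⟨htr⟩
  have hwf := Finite.wellFounded_of_trans_of_irrefl (Precedes (LexLT (n := n) (k := k)))
  obtain ⟨G, hG, hmin⟩ := hwf.has_min
    {G | G.card = F.card ∧ WeaklyIsomorphic (genericMatrix n) G F}
    ⟨F, rfl, dominates_generic_self F, dominates_generic_self F⟩
  refine ⟨G, ⟨hG, fun G' h1 h2 hne => ?_⟩, ?_⟩
  · rcases Precedes.total LexLT.total LexLT.irrefl LexLT.trans G G' with h | h | h
    · exact h
    · exact absurd h.symm hne
    · exact absurd h (hmin G' ⟨h1, h2⟩)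
  · rintro G' ⟨hG', h'⟩
    by_contra hne
    exact hmin G' hG' (h' G hG.1 hG.2 (Ne.symm hne))

/-- The exterior shifting `F^{<_L}` of `F` with respect to the lexicographic order. -/
noncomputable def lexShifting {n k : ℕ} (F : Finset (Set.powersetCard (Fin n) k)) :
    Finset (Set.powersetCard (Fin n) k) :=
  (existsUnique_lexShifting F).choose

theorem lexShifting_spec {n k : ℕ} (F : Finset (Set.powersetCard (Fin n) k)) :
    IsExteriorShifting LexLT (genericMatrix n) F (lexShifting F) :=
  (existsUnique_lexShifting F).choose_spec.1

/-- A Turán hypergraph on `[n]`: a `3`-uniform hypergraph such that any `4` vertices span an edge. -/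
def IsTuranHypergraph {n : ℕ} (H : Finset (Set.powersetCard (Fin n) 3)) : Prop :=
  ∀ Q : Finset (Fin n), Q.card = 4 → ∃ F ∈ H, (F : Finset (Fin n)) ⊆ Q

/-! The sets containing the least vertex form an initial segment `C` of the lexicographic order, so
by basis exchange the shifting of `H` contains at least as many of them as the rank of the generic
minors with rows `H` and columns `C`. Specializing variables cannot raise this rank. At `coneMatrix`
the matrix becomes the simplicial coboundary restricted to the triangles of `H`, acting on
alternating 1-cochains that vanish on every edge at 0. It has `(n-1).choose 2` columns, so it
suffices that the kernel has dimension at most `n - 2`.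

This is the combinatorial core, `exists_triangles_closed`: imposing closedness on `n - 2` further
triangles forces a cochain closed on `H` to be closed everywhere, and a closed cochain vanishing at
0 is zero. The extra triangles come from deleting vertices one at a time. If the link of `v` has at
most two components, one triangle through `v` joining them suffices. Such a `v` exists by
`exists_link_not_three_colorable`: were all links to have three or more components, a smallest
colour class over all 3-colourings of links would yield a smaller one. -/

/-! ### Links and closed cochains in Turán hypergraphs -/

/-- In a set `s` of vertices every four of which span a triangle of `T`, not every link can be
coloured with three colours such that adjacent vertices get the same colour. -/
theorem exists_link_not_three_colorable {α : Type*} [DecidableEq α] {T : α → α → α → Prop}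
    {s : Finset α} (hs : s.Nonempty)
    (hT : ∀ a ∈ s, ∀ b ∈ s, ∀ c ∈ s, ∀ d ∈ s, a ≠ b → a ≠ c → a ≠ d → b ≠ c → b ≠ d → c ≠ d →
      T a b c ∨ T a b d ∨ T a c d ∨ T b c d) :
    ∃ v ∈ s, ∀ f : α → Fin 3, (∀ i ∈ s.erase v, ∀ j ∈ s.erase v, T v i j → f i = f j) →
      ∃ c, ∀ i ∈ s.erase v, f i ≠ c := by
  by_contra! hcon
  -- Infinite descent on the size of a colour class, over all links and their surjective colourings.
  have key : ∀ (m : ℕ) (v : α) (f : α → Fin 3) (c : Fin 3), v ∈ s →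
      (∀ i ∈ s.erase v, ∀ j ∈ s.erase v, T v i j → f i = f j) →
      (∀ c, ∃ i ∈ s.erase v, f i = c) → ((s.erase v).filter fun i => f i = c).card < m → False := by
    intro m
    induction m with
    | zero => intro _ _ _ _ _ _ h; exact absurd h (Nat.not_lt_zero _)
    | succ m ih =>
      intro v f c hv hf hsur hcard
      obtain ⟨i, hi, hic⟩ := hsur c
      obtain ⟨f', hf', hsur'⟩ := hcon i (Finset.mem_of_mem_erase hi)
      -- With `i` of colour `c` and `x`, `y` of two other colours, no triangle at `v` lies in `{v,
      -- i, x, y}`; hence `i x y` is a triangle, an edge in the link of `i`.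
      have htrans : ∀ x ∈ s.erase v, ∀ y ∈ s.erase v, f x ≠ c → f y ≠ c → f x ≠ f y →
          f' x = f' y := by
        intro x hx y hy hxc hyc hxy
        have hix : i ≠ x := fun h => hxc (h ▸ hic)
        have hiy : i ≠ y := fun h => hyc (h ▸ hic)
        have hxy' : x ≠ y := fun h => hxy (h ▸ rfl)
        refine hf' x (Finset.mem_erase.2 ⟨hix.symm, Finset.mem_of_mem_erase hx⟩) y
          (Finset.mem_erase.2 ⟨hiy.symm, Finset.mem_of_mem_erase hy⟩) ?_
        rcases hT v hv i (Finset.mem_of_mem_erase hi) x (Finset.mem_of_mem_erase hx) y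
          (Finset.mem_of_mem_erase hy) (Finset.ne_of_mem_erase hi).symm
          (Finset.ne_of_mem_erase hx).symm (Finset.ne_of_mem_erase hy).symm hix hiy hxy'
          with h | h | h | h
        · exact absurd ((hf i hi x hx h).symm.trans hic) hxc
        · exact absurd ((hf i hi y hy h).symm.trans hic) hyc
        · exact absurd (hf x hx y hy h) hxy
        · exact h
      obtain ⟨d, hd⟩ : ∃ d : Fin 3, d ≠ c := exists_ne c
      obtain ⟨x₀, hx₀, hx₀d⟩ := hsur d
      have hconst : ∀ x ∈ s.erase v, f x ≠ c → f' x = f' x₀ := by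
        intro x hx hxc
        by_cases hxd : f x = d
        -- Vertices of the same colour `d` are compared through a vertex of the third colour.
        · obtain ⟨e, hec, hed⟩ : ∃ e : Fin 3, e ≠ c ∧ e ≠ d := by
            clear * - hd; revert c d; decide
          obtain ⟨z, hz, hze⟩ := hsur e
          have h1 := htrans x hx z hz hxc (hze ▸ hec) (by rw [hxd, hze]; exact hed.symm)
          have h2 := htrans x₀ hx₀ z hz (hx₀d ▸ hd) (hze ▸ hec) (by rw [hx₀d, hze]; exact hed.symm)
          rw [h1, h2]
        · exact htrans x hx x₀ hx₀ hxc (hx₀d ▸ hd) (by rw [hx₀d]; exact hxd)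
      -- Everything outside class `c`, and also `v`, misses colour `c'` under `f'`. The class of
      -- `c'` thus lies in the class of `c`, and it omits `i`.
      obtain ⟨c', h1, h2⟩ : ∃ c' : Fin 3, c' ≠ f' x₀ ∧ c' ≠ f' v := by
        generalize f' x₀ = p
        generalize f' v = q
        revert p q; decide
      refine ih i f' c' (Finset.mem_of_mem_erase hi) hf' hsur' ?_
      refine lt_of_lt_of_le (Finset.card_lt_card ?_) (Nat.lt_succ_iff.1 hcard)
      rw [Finset.ssubset_iff_of_subset]
      · exact ⟨i, by simp [hi, hic], by simp⟩
      · intro x hx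
        simp only [Finset.mem_filter, Finset.mem_erase] at hx ⊢
        have hxv : x ≠ v := fun h => h2 (by rw [← hx.2, h])
        refine ⟨⟨hxv, hx.1.2⟩, ?_⟩
        by_contra hxc
        exact h1 (by rw [← hx.2, hconst x (Finset.mem_erase.2 ⟨hxv, hx.1.2⟩) hxc])
  obtain ⟨v, hv⟩ := hs
  obtain ⟨f, hf, hsur⟩ := hcon v hv
  exact key _ v f 0 hv hf hsur (Nat.lt_succ_self _)

/-- A relation admitting no surjective locally constant map to three colours has at most two
connected components. -/
theorem exists_pair_eqvGen {α : Type*} {r : α → α → Prop} {s : Finset α} (hs : s.Nonempty)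
    (h : ∀ f : α → Fin 3, (∀ i ∈ s, ∀ j ∈ s, r i j → f i = f j) → ∃ c, ∀ i ∈ s, f i ≠ c) :
    ∃ a ∈ s, ∃ b ∈ s, ∀ i ∈ s, Relation.EqvGen r a i ∨ Relation.EqvGen r b i := by
  classical
  obtain ⟨a, ha⟩ := hs
  by_contra! hcon
  obtain ⟨b, hb, hab, -⟩ := hcon a ha a ha
  obtain ⟨c, hc, hac, hbc⟩ := hcon a ha b hb
  have hiff : ∀ x i j, r i j → (Relation.EqvGen r x i ↔ Relation.EqvGen r x j) := fun x i j hij =>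
    ⟨fun h => h.trans _ _ _ (.rel _ _ hij), fun h => h.trans _ _ _ ((Relation.EqvGen.rel _ _ hij).symm)⟩
  obtain ⟨d, hd⟩ := h (fun i => if Relation.EqvGen r a i then 0 else
    if Relation.EqvGen r b i then 1 else 2) (fun i _ j _ hij => by
      simp only [hiff a i j hij, hiff b i j hij])
  have h0 := hd a ha
  have h1 := hd b hb
  have h2 := hd c hc
  simp only [Relation.EqvGen.refl, hab, hac, hbc, if_true, if_false] at h0 h1 h2
  revert h0 h1 h2
  clear * -
  revert d
  decide

/-- If every four vertices of `s` span a triangle of `T`, then adding at most `|s| - 2` triangles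
makes every alternating `1`-cochain that is closed on all triangles of `T` closed on `s`. -/
theorem exists_triangles_closed {α K : Type*} [DecidableEq α] [CommRing K] {T : α → α → α → Prop}
    (m : ℕ) :
    ∀ s : Finset α, s.card = m + 2 →
    (∀ a ∈ s, ∀ b ∈ s, ∀ c ∈ s, ∀ d ∈ s, a ≠ b → a ≠ c → a ≠ d → b ≠ c → b ≠ d → c ≠ d →
      T a b c ∨ T a b d ∨ T a c d ∨ T b c d) →
    ∃ R : Finset (α × α × α), R.card ≤ m ∧ ∀ w : α → α → K, (∀ i, w i i = 0) →
      (∀ i j, w i j = - w j i) →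
      (∀ i ∈ s, ∀ j ∈ s, ∀ k ∈ s, T i j k → w i j + w j k + w k i = 0) →
      (∀ p ∈ R, w p.1 p.2.1 + w p.2.1 p.2.2 + w p.2.2 p.1 = 0) →
      ∀ i ∈ s, ∀ j ∈ s, ∀ k ∈ s, w i j + w j k + w k i = 0 := by
  induction m with
  | zero =>
    intro s hs _
    obtain ⟨x, y, hxy, rfl⟩ := Finset.card_eq_two.1 hs
    refine ⟨∅, le_rfl, fun w h0 hw _ _ => ?_⟩
    have := hw x y
    simp only [Finset.mem_insert, Finset.mem_singleton]
    rintro i (rfl | rfl) j (rfl | rfl) k (rfl | rfl) <;> simp [h0, this]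
  | succ m ih =>
    intro s hs hT
    obtain ⟨v, hv, hlink⟩ := exists_link_not_three_colorable
      (Finset.card_pos.1 (by omega)) hT
    have hs' : (s.erase v).card = m + 2 := by rw [Finset.card_erase_of_mem hv]; omega
    have hmem : ∀ {x}, x ∈ s.erase v → x ∈ s := Finset.mem_of_mem_erase
    obtain ⟨R, hR, hRw⟩ := ih (s.erase v) hs' fun a ha b hb c hc d hd =>
      hT a (hmem ha) b (hmem hb) c (hmem hc) d (hmem hd)
    obtain ⟨a, ha, b, hb, hab⟩ := exists_pair_eqvGen
      (r := fun i j => i ∈ s.erase v ∧ j ∈ s.erase v ∧ T v i j) (Finset.card_pos.1 (by omega))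
      (fun f hf => hlink f fun i hi j hj hij => hf i hi j hj ⟨hi, hj, hij⟩)
    -- The new triangle joins the two components of the link of `v`, represented by `a` and `b`.
    refine ⟨insert (v, a, b) R, (Finset.card_insert_le _ _).trans (by omega), ?_⟩
    intro w h0 hw hwT hwR
    have hcl := hRw w h0 hw
      (fun i hi j hj k hk => hwT i (hmem hi) j (hmem hj) k (hmem hk))
      (fun p hp => hwR p (Finset.mem_insert_of_mem hp))
    have hvab : w v a + w a b + w b v = 0 := hwR (v, a, b) (Finset.mem_insert_self _ _)
    -- Closedness on `v i j` propagates along paths in the link, because all triangles avoiding `v`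
    -- are already closed. The case `i = j` is separate since `EqvGen` is reflexive also outside
    -- `s.erase v`.
    have hE : ∀ i j, Relation.EqvGen (fun i j => i ∈ s.erase v ∧ j ∈ s.erase v ∧ T v i j) i j →
        i = j ∨ (i ∈ s.erase v ∧ j ∈ s.erase v ∧ w v i + w i j + w j v = 0) := by
      intro i j hij
      induction hij with
      | rel x y h => exact Or.inr ⟨h.1, h.2.1, hwT v hv x (hmem h.1) y (hmem h.2.1) h.2.2⟩
      | refl x => exact Or.inl rfl
      | symm x y _ h =>
        rcases h with h | ⟨h1, h2, h3⟩
        · exact Or.inl h.symm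
        · refine Or.inr ⟨h2, h1, ?_⟩
          linear_combination -h3 + hw v y + hw y x + hw x v
      | trans x y z _ _ h h' =>
        rcases h with rfl | ⟨h1, h2, h3⟩
        · exact h'
        · rcases h' with rfl | ⟨h4, h5, h6⟩
          · exact Or.inr ⟨h1, h2, h3⟩
          · refine Or.inr ⟨h1, h5, ?_⟩
            have := hcl x h1 y h2 z h5
            linear_combination h3 + h6 - this + hw x z - hw y v
    have hE' : ∀ i j, i ∈ s.erase v → j ∈ s.erase v →
        Relation.EqvGen (fun i j => i ∈ s.erase v ∧ j ∈ s.erase v ∧ T v i j) i j →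
        w v i + w i j + w j v = 0 := by
      intro i j hi hj h
      rcases hE i j h with rfl | h
      · linear_combination h0 i + hw v i
      · exact h.2.2
    have hva : ∀ i ∈ s.erase v, w v a + w a i + w i v = 0 := by
      intro i hi
      rcases hab i hi with h | h
      · exact hE' a i ha hi h
      · have h1 := hE' b i hb hi h
        have h2 := hcl a ha b hb i hi
        linear_combination hvab + h1 - h2 + hw a i - hw b v
    have hvij : ∀ i ∈ s.erase v, ∀ j ∈ s.erase v, w v i + w i j + w j v = 0 := by
      intro i hi j hj
      have h1 := hva i hi
      have h2 := hva j hj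
      have h3 := hcl a ha i hi j hj
      linear_combination h2 - h1 + h3 + hw v i - hw a j
    have hv' : ∀ x ∈ s, x = v ∨ x ∈ s.erase v := fun x hx => by
      by_cases h : x = v
      · exact Or.inl h
      · exact Or.inr (Finset.mem_erase.2 ⟨h, hx⟩)
    intro i hi j hj k hk
    rcases hv' i hi with rfl | hi' <;> rcases hv' j hj with rfl | hj' <;>
      rcases hv' k hk with rfl | hk'
    · simp [h0]
    · linear_combination h0 j + hw j k
    · linear_combination h0 k + hw k j
    · exact hvij j hj' k hk'
    · linear_combination h0 k + hw i k
    · linear_combination hvij k hk' i hi'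
    · linear_combination hvij i hi' j hj'
    · exact hcl i hi' j hj' k hk'

/-! ### Rank under specialization and transposition -/

/-- The rank of a matrix of rank `r` is witnessed by an identity matrix of size `r`. -/
theorem Matrix.exists_mul_mul_eq_one {m n K : Type*} [Fintype m] [Fintype n] [Field K]
    (M : Matrix m n K) {r : ℕ} (hr : M.rank = r) :
    ∃ (B : Matrix (Fin r) m K) (C : Matrix n (Fin r) K), B * M * C = 1 := by
  classical
  -- The columns of `C` are preimages of a basis of the range; `B` is a left inverse of the
  -- inclusion of that basis.
  let b := Module.finBasisOfFinrankEq K (LinearMap.range M.mulVecLin) hr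
  choose c hc using fun i => (b i).2
  have hinj : LinearMap.ker ((LinearMap.range M.mulVecLin).subtype ∘ₗ
      b.equivFun.symm.toLinearMap) = ⊥ := by
    rw [LinearMap.ker_eq_bot]
    exact (Submodule.subtype_injective _).comp b.equivFun.symm.injective
  obtain ⟨g, hg⟩ := LinearMap.exists_leftInverse_of_injective _ hinj
  refine ⟨LinearMap.toMatrix' g, (Matrix.of c).transpose, ?_⟩
  ext i j
  have h1 : g (M.mulVec (c j)) = Pi.single j 1 := by
    have h := LinearMap.congr_fun hg (Pi.single j 1)
    have h2 : b.equivFun.symm (Pi.single j 1) = b j := by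
      rw [LinearEquiv.symm_apply_eq]
      ext i
      simp [Pi.single_apply, eq_comm]
    simp only [LinearMap.comp_apply, LinearEquiv.coe_coe, h2, Submodule.subtype_apply,
      LinearMap.id_apply, ← hc j] at h
    exact h
  have h3 := congrFun h1 i
  rw [← LinearMap.toMatrix'_mulVec, Matrix.mulVec_mulVec] at h3
  rw [Matrix.one_apply, Matrix.mul_apply]
  rw [Pi.single_apply] at h3
  rw [← h3]
  rfl

/-- Specialization does not increase the rank. -/
theorem Matrix.rank_map_le_rank_map {m n D K L : Type*} [Fintype m] [Fintype n]
    [CommRing D] [Field K] [Field L] {e : D →+* L} (he : Function.Surjective e) {a : D →+* K}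
    (ha : Function.Injective a) (P : Matrix m n D) : (P.map e).rank ≤ (P.map a).rank := by
  obtain ⟨r, hr⟩ : ∃ r, (P.map e).rank = r := ⟨_, rfl⟩
  obtain ⟨B, C, hBC⟩ := (P.map e).exists_mul_mul_eq_one hr
  rw [hr]
  obtain ⟨B, rfl⟩ : ∃ B' : Matrix _ _ D, B'.map e = B :=
    ⟨B.map (Function.surjInv he), by ext; simp [Function.surjInv_eq]⟩
  obtain ⟨C, rfl⟩ : ∃ C' : Matrix _ _ D, C'.map e = C :=
    ⟨C.map (Function.surjInv he), by ext; simp [Function.surjInv_eq]⟩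
  -- The determinant over `D` maps to 1 under `e`, so it is nonzero and stays nonzero under the
  -- injection `a`.
  have hdet : (B * P * C).det ≠ 0 := by
    intro h
    have := RingHom.map_det e (B * P * C)
    rw [h, map_zero, RingHom.mapMatrix_apply, Matrix.map_mul, Matrix.map_mul, hBC,
      Matrix.det_one] at this
    exact zero_ne_one this
  have hdet' : (B.map a * P.map a * C.map a).det ≠ 0 := by
    rw [← Matrix.map_mul, ← Matrix.map_mul, ← RingHom.mapMatrix_apply, ← RingHom.map_det]
    exact fun h => hdet (ha (by rw [h, map_zero]))
  calc r = (B.map a * P.map a * C.map a).rank := by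
        rw [Matrix.rank_of_det_ne_zero hdet', Fintype.card_fin]
    _ ≤ (B.map a * P.map a).rank := Matrix.rank_mul_le_left _ _
    _ ≤ (P.map a).rank := Matrix.rank_mul_le_right _ _

theorem compoundSub_map {n k : ℕ} {K L : Type*} [CommRing K] [CommRing L] (f : K →+* L)
    (A : Matrix (Fin n) (Fin n) K) (E₁ E₂ : Finset (Set.powersetCard (Fin n) k)) :
    compoundSub (A.map f) E₁ E₂ = (compoundSub A E₁ E₂).map f := by
  unfold compoundSub
  rw [compound_map]
  rfl

theorem compoundSub_transpose {n k : ℕ} {K : Type*} [CommRing K]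
    (A : Matrix (Fin n) (Fin n) K) (E₁ E₂ : Finset (Set.powersetCard (Fin n) k)) :
    compoundSub A.transpose E₁ E₂ = (compoundSub A E₂ E₁).transpose := by
  ext S T
  simp only [compoundSub, compound, Matrix.transpose_apply, Matrix.submatrix_apply,
    Matrix.of_apply]
  rw [← Matrix.det_transpose]
  rfl

/-- The minors of the generic matrix have at least the rank of their specializations. -/
theorem rank_compoundSub_le_generic {n k : ℕ} (A : Matrix (Fin n) (Fin n) ℚ)
    (E₁ E₂ : Finset (Set.powersetCard (Fin n) k)) :
    (compoundSub A E₁ E₂).rank ≤ (compoundSub (genericMatrix n) E₁ E₂).rank := by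
  set P : Matrix (Fin n) (Fin n) (MvPolynomial (Fin n × Fin n) ℚ) :=
    Matrix.of fun i j => MvPolynomial.X (i, j) with hP
  have h1 : A = P.map (MvPolynomial.eval fun p => A p.1 p.2) := by
    ext i j
    simp [hP]
  have h2 : genericMatrix n = P.map (algebraMap (MvPolynomial (Fin n × Fin n) ℚ)
    (FractionRing (MvPolynomial (Fin n × Fin n) ℚ))) := rfl
  rw [h2, compoundSub_map]
  conv_lhs => rw [h1, compoundSub_map]
  exact Matrix.rank_map_le_rank_map (fun q => ⟨MvPolynomial.C q, by simp⟩)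
    (IsFractionRing.injective _ _) _

/-- Exchanging the variables `x_{i,j}` and `x_{j,i}` is a field automorphism taking the generic
matrix to its transpose. -/
theorem rank_compoundSub_generic_comm {n k : ℕ} (E₁ E₂ : Finset (Set.powersetCard (Fin n) k)) :
    (compoundSub (genericMatrix n) E₁ E₂).rank ≤ (compoundSub (genericMatrix n) E₂ E₁).rank := by
  let σ : FractionRing (MvPolynomial (Fin n × Fin n) ℚ) ≃+*
      FractionRing (MvPolynomial (Fin n × Fin n) ℚ) :=
    IsFractionRing.ringEquivOfRingEquiv
      (MvPolynomial.renameEquiv ℚ (Equiv.prodComm (Fin n) (Fin n))).toRingEquiv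
  have h : (genericMatrix n).map σ.toRingHom = (genericMatrix n).transpose := by
    ext i j
    simp [genericMatrix, σ]
  rw [← Matrix.rank_transpose (compoundSub (genericMatrix n) E₂ E₁), ← compoundSub_transpose, ← h,
    compoundSub_map]
  exact Matrix.rank_map_le_rank_map (e := RingHom.id _) (a := σ.toRingHom) Function.surjective_id
    σ.injective (compoundSub (genericMatrix n) E₁ E₂)

theorem weaklyIsomorphic_generic {n k : ℕ} {E₁ E₂ : Finset (Set.powersetCard (Fin n) k)}
    (hcard : E₁.card = E₂.card) (h : E₂.card ≤ (compoundSub (genericMatrix n) E₁ E₂).rank) :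
    WeaklyIsomorphic (genericMatrix n) E₁ E₂ :=
  ⟨le_antisymm ((Matrix.rank_le_card_height _).trans_eq (Fintype.card_coe _)) h,
    le_antisymm ((Matrix.rank_le_card_height _).trans_eq (Fintype.card_coe _))
      (hcard.trans_le (h.trans (rank_compoundSub_generic_comm _ _)))⟩

/-! ### Basis exchange in the lexicographic shifting -/

open Module in
/-- The rank of the columns in an initial segment of the lexicographic order which consists of all
sets containing the least element bounds from below the number of such sets in the shifting. -/
theorem rank_le_card_filter_lexShifting {n k : ℕ} (H C : Finset (Set.powersetCard (Fin n) k))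
    (hC : ∀ F, F ∈ C ↔ ∃ i ∈ (F : Finset (Fin n)), (i : ℕ) = 0) :
    (compoundSub (genericMatrix n) C H).rank ≤
      ((lexShifting H).filter fun F : Set.powersetCard (Fin n) k =>
        ∃ i ∈ (F : Finset (Fin n)), (i : ℕ) = 0).card := by
  classical
  obtain ⟨⟨hcard, hdom, -⟩, hmin⟩ := lexShifting_spec H
  set G := lexShifting H
  set K := FractionRing (MvPolynomial (Fin n × Fin n) ℚ)
  simp only [← hC]
  set G₀ := G.filter (· ∈ C) with hG₀
  have hG₀G : (G₀ : Set (Set.powersetCard (Fin n) k)) ⊆ G :=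
    Finset.coe_subset.2 (Finset.filter_subset _ _)
  let col : Set.powersetCard (Fin n) k → ({S // S ∈ H} → K) :=
    fun T S => compound k (genericMatrix n) S.1 T
  have hspan : ∀ E : Finset (Set.powersetCard (Fin n) k),
      (compoundSub (genericMatrix n) E H).rank = finrank K (Submodule.span K (col '' E)) := by
    intro E
    rw [Matrix.rank_eq_finrank_span_cols, Set.image_eq_range]
    rfl
  have hli : ∀ E : Finset (Set.powersetCard (Fin n) k), LinearIndepOn K col E →
      finrank K (Submodule.span K (col '' E)) = E.card := by
    intro E hE
    rw [Set.image_eq_range]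
    exact (finrank_span_eq_card (b := fun i : (E : Set (Set.powersetCard (Fin n) k)) => col i)
      hE).trans (by simp)
  have hdim : finrank K ({S // S ∈ H} → K) = H.card := by simp
  -- Dominance and equal cardinality make the columns indexed by `G` a basis of `K^H`.
  have htop : Submodule.span K (col '' G) = ⊤ := by
    apply Submodule.eq_top_of_finrank_eq
    rw [← hspan, hdim]
    exact hdom
  have hGli : LinearIndepOn K col G := by
    have h1 : LinearIndependent K (fun i : (G : Set (Set.powersetCard (Fin n) k)) => col i) := by
      apply linearIndependent_of_top_le_span_of_card_eq_finrank
      · rw [← Set.image_eq_range, htop]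
      · rw [hdim, ← hcard]; simp
    exact h1
  by_contra! hlt
  obtain ⟨T, hTC, hT⟩ : ∃ T ∈ C, col T ∉ Submodule.span K (col '' G₀) := by
    by_contra! hcon
    refine hlt.not_ge ?_
    rw [hspan, ← hli G₀ (hGli.mono hG₀G)]
    refine Submodule.finrank_mono (Submodule.span_le.2 ?_)
    rintro _ ⟨T, hT, rfl⟩
    exact hcon T hT
  have hTG : T ∉ G := fun h =>
    hT (Submodule.subset_span ⟨T, Finset.mem_filter.2 ⟨h, hTC⟩, rfl⟩)
  have hI : LinearIndepOn K col (insert T (G₀ : Set (Set.powersetCard (Fin n) k))) :=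
    (hGli.mono hG₀G).insert hT
  -- The new basis contains `G₀` and `T` and otherwise uses only members of `G`, so whatever leaves
  -- `G` lies outside `C` and is lexicographically after `T`.
  obtain ⟨b, hbt, hsb, hb, hbli⟩ := exists_linearIndepOn_extension hI
    (Set.insert_subset_insert hG₀G :
      _ ⊆ insert T (G : Set (Set.powersetCard (Fin n) k)))
  obtain ⟨G', rfl⟩ : ∃ G' : Finset (Set.powersetCard (Fin n) k), (G' : Set _) = b :=
    ⟨(Set.toFinite b).toFinset, by simp⟩
  have hb' : Submodule.span K (col '' (G' : Set (Set.powersetCard (Fin n) k))) = ⊤ := by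
    rw [eq_top_iff, ← htop, Submodule.span_le]
    exact (Set.image_mono (Set.subset_insert _ _)).trans hb
  have hcard' : G'.card = H.card := by
    rw [← hli G' hbli, hb', finrank_top, hdim]
  have hTG' : T ∈ G' := hsb (Set.mem_insert _ _)
  have hprec : Precedes LexLT G' G := by
    refine ⟨T, hTG', hTG, ?_⟩
    rintro S (⟨h1, h2⟩ | ⟨h1, h2⟩)
    · rcases hbt h1 with h | h
      · exact Or.inl h
      · exact absurd h h2
    · right
      have hS : S ∉ C := fun h => h2 (hsb (Or.inr (Finset.mem_filter.2 ⟨h1, h⟩)))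
      obtain ⟨i, hiT, hi⟩ := (hC T).1 hTC
      have hiS : i ∉ (S : Finset (Fin n)) := fun h => hS ((hC S).2 ⟨i, h, hi⟩)
      refine ⟨i, hiT, hiS, fun j _ => ?_⟩
      rcases Nat.eq_zero_or_pos (j : ℕ) with h | h
      · exact Or.inl (Fin.ext (h.trans hi.symm))
      · exact Or.inr (Fin.lt_def.2 (hi ▸ h))
  have hne : G' ≠ G := fun h => hTG (h ▸ hTG')
  have hiso : WeaklyIsomorphic (genericMatrix n) G' H := by
    refine weaklyIsomorphic_generic hcard' ?_
    rw [hspan, hb', finrank_top, hdim]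
  exact Precedes.irrefl G' (hprec.trans LexLT.total LexLT.irrefl LexLT.trans
    (hmin G' hcard' hiso hne))

/-! ### The coboundary matrix as a specialization -/

/-- The matrix whose first column consists of ones and whose other columns are unit vectors. -/
def coneMatrix (m : ℕ) : Matrix (Fin (m + 2)) (Fin (m + 2)) ℚ :=
  Matrix.of fun i j => if j = 0 then 1 else if i = j then 1 else 0

/-- The columns of the third compound of `coneMatrix` indexed by sets containing the first vertex
form the simplicial coboundary matrix. -/
theorem exists_compound_coneMatrix {m : ℕ} (F : Set.powersetCard (Fin (m + 2)) 3) :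
    ∃ a b c : Fin (m + 2), a < b ∧ b < c ∧ (F : Finset (Fin (m + 2))) = {a, b, c} ∧
      ∀ T : Set.powersetCard (Fin (m + 2)) 3, 0 ∈ (T : Finset (Fin (m + 2))) →
        compound 3 (coneMatrix m) F T =
          (if (T : Finset (Fin (m + 2))) = {0, b, c} then 1 else 0) -
          (if (T : Finset (Fin (m + 2))) = {0, a, c} then 1 else 0) +
          (if (T : Finset (Fin (m + 2))) = {0, a, b} then 1 else 0) := by
  have himage : ∀ S : Set.powersetCard (Fin (m + 2)) 3, (S : Finset (Fin (m + 2))) =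
      {(S : Finset (Fin (m + 2))).orderEmbOfFin (Set.powersetCard.card_eq S) 0,
        (S : Finset (Fin (m + 2))).orderEmbOfFin (Set.powersetCard.card_eq S) 1,
        (S : Finset (Fin (m + 2))).orderEmbOfFin (Set.powersetCard.card_eq S) 2} := by
    intro S
    conv_lhs => rw [← Finset.image_orderEmbOfFin_univ _ (Set.powersetCard.card_eq S),
      show (Finset.univ : Finset (Fin 3)) = {0, 1, 2} from rfl, Finset.image_insert,
      Finset.image_insert, Finset.image_singleton]
  refine ⟨(F : Finset (Fin (m + 2))).orderEmbOfFin (Set.powersetCard.card_eq F) 0,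
    (F : Finset (Fin (m + 2))).orderEmbOfFin (Set.powersetCard.card_eq F) 1,
    (F : Finset (Fin (m + 2))).orderEmbOfFin (Set.powersetCard.card_eq F) 2, by simp, by simp, himage F, ?_⟩
  intro T hT
  have hT0 : (T : Finset (Fin (m + 2))).orderEmbOfFin (Set.powersetCard.card_eq T) 0 = 0 := by
    refine (Finset.orderEmbOfFin_zero (Set.powersetCard.card_eq T) (by norm_num)).trans ?_
    exact le_antisymm (Finset.min'_le _ _ hT) (Fin.zero_le _)
  have hTi := himage T
  rw [hT0] at hTi
  have hab : (F : Finset (Fin (m + 2))).orderEmbOfFin (Set.powersetCard.card_eq F) 0 <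
    (F : Finset (Fin (m + 2))).orderEmbOfFin (Set.powersetCard.card_eq F) 1 := by simp
  have hbc : (F : Finset (Fin (m + 2))).orderEmbOfFin (Set.powersetCard.card_eq F) 1 <
    (F : Finset (Fin (m + 2))).orderEmbOfFin (Set.powersetCard.card_eq F) 2 := by simp
  have h0j : 0 < (T : Finset (Fin (m + 2))).orderEmbOfFin (Set.powersetCard.card_eq T) 1 := by
    rw [← hT0]; simp
  have hjk : (T : Finset (Fin (m + 2))).orderEmbOfFin (Set.powersetCard.card_eq T) 1 <
    (T : Finset (Fin (m + 2))).orderEmbOfFin (Set.powersetCard.card_eq T) 2 := by simp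
  simp only [compound, Matrix.of_apply, Matrix.det_fin_three, Matrix.submatrix_apply, coneMatrix,
    hT0]
  clear himage
  generalize (F : Finset (Fin (m + 2))).orderEmbOfFin (Set.powersetCard.card_eq F) 0 = a at *
  generalize (F : Finset (Fin (m + 2))).orderEmbOfFin (Set.powersetCard.card_eq F) 1 = b at *
  generalize (F : Finset (Fin (m + 2))).orderEmbOfFin (Set.powersetCard.card_eq F) 2 = c at *
  generalize (T : Finset (Fin (m + 2))).orderEmbOfFin (Set.powersetCard.card_eq T) 1 = j at *
  generalize (T : Finset (Fin (m + 2))).orderEmbOfFin (Set.powersetCard.card_eq T) 2 = k at *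
  rw [hTi]
  have key : ∀ x y : Fin (m + 2), x < y →
      (({0, j, k} : Finset (Fin (m + 2))) = {0, x, y} ↔ x = j ∧ y = k) := by
    intro x y hxy
    constructor
    · intro h
      have hj : j ∈ ({0, x, y} : Finset (Fin (m + 2))) := h ▸ by simp
      have hk : k ∈ ({0, x, y} : Finset (Fin (m + 2))) := h ▸ by simp
      simp only [Finset.mem_insert, Finset.mem_singleton] at hj hk
      have h0k := h0j.trans hjk
      rcases hj with rfl | rfl | rfl
      · exact absurd h0j (lt_irrefl _)
      · rcases hk with rfl | rfl | rfl
        · exact absurd h0k (lt_irrefl _)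
        · exact absurd hjk (lt_irrefl _)
        · exact ⟨rfl, rfl⟩
      · rcases hk with rfl | rfl | rfl
        · exact absurd h0k (lt_irrefl _)
        · exact absurd hjk hxy.asymm
        · exact absurd hjk (lt_irrefl _)
    · rintro ⟨rfl, rfl⟩; rfl
  -- In the expansion along the column of ones, each 2-minor has one product that respects the order
  -- of `j < k` and one that reverses it; the latter vanishes.
  have key' : ∀ x y : Fin (m + 2), x < y → ¬ (y = j ∧ x = k) := by
    rintro x y hxy ⟨rfl, rfl⟩
    exact hxy.asymm hjk
  simp only [key b c hbc, key a b hab, key a c (hab.trans hbc), h0j.ne', (h0j.trans hjk).ne',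
    if_true, if_false, one_mul, mul_one]
  have hand : ∀ p q : Prop, [Decidable p] → [Decidable q] →
      (if p then (1 : ℚ) else 0) * (if q then 1 else 0) = if p ∧ q then 1 else 0 := by
    intro p q _ _
    split_ifs <;> simp_all
  have h1 := key' b c hbc
  have h2 := key' a b hab
  have h3 := key' a c (hab.trans hbc)
  rw [and_comm] at h1 h2 h3
  simp only [hand, h1, h2, h3, if_false]
  ring

theorem choose_le_card_filter_zero_mem (m : ℕ) (C : Finset (Set.powersetCard (Fin (m + 2)) 3))
    (hC : ∀ F, F ∈ C ↔ 0 ∈ (F : Finset (Fin (m + 2)))) : (m + 1).choose 2 ≤ C.card := by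
  have h : Finset.powersetCard 2 ((Finset.univ : Finset (Fin (m + 2))).erase 0) ⊆
      C.image fun F : Set.powersetCard (Fin (m + 2)) 3 => (F : Finset (Fin (m + 2))).erase 0 := by
    intro S hS
    rw [Finset.mem_powersetCard] at hS
    have h0 : (0 : Fin (m + 2)) ∉ S := fun h => by simpa using hS.1 h
    refine Finset.mem_image.2 ⟨⟨(insert 0 S : Finset (Fin (m + 2))), ?_⟩, (hC _).2 ?_, ?_⟩
    · rw [Set.powersetCard.mem_iff, Finset.card_insert_of_notMem h0, hS.2]
    · exact Finset.mem_insert_self _ _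
    · exact Finset.erase_insert h0
  have h' := (Finset.card_le_card h).trans Finset.card_image_le
  simpa using h'

/-- The coboundary matrix of a Turán hypergraph has large rank. -/
theorem choose_le_rank_coneMatrix {m : ℕ} (H C : Finset (Set.powersetCard (Fin (m + 2)) 3))
    (hH : IsTuranHypergraph H) (hC : ∀ F, F ∈ C ↔ 0 ∈ (F : Finset (Fin (m + 2)))) :
    m.choose 2 ≤ (compoundSub (coneMatrix m) C H).rank := by
  classical
  obtain ⟨R, hR, hRw⟩ := exists_triangles_closed (K := ℚ)
    (T := fun i j k : Fin (m + 2) => ∃ F ∈ H, (F : Finset (Fin (m + 2))) = {i, j, k}) m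
    Finset.univ (by simp) (by
      intro a _ b _ c _ d _ hab hac had hbc hbd hcd
      obtain ⟨F, hF, hFQ⟩ := hH {a, b, c, d} (by
        rw [Finset.card_insert_of_notMem (by simp [*]), Finset.card_eq_three.2
          ⟨b, c, d, hbc, hbd, hcd, rfl⟩])
      have hcard : ∀ x y z w : Fin (m + 2), (F : Finset (Fin (m + 2))) ⊆ {x, y, z, w} →
          w ∉ (F : Finset (Fin (m + 2))) → (F : Finset (Fin (m + 2))) = {x, y, z} := by
        intro x y z w hs hw
        refine Finset.eq_of_subset_of_card_le (fun t ht => ?_)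
          (Finset.card_le_three.trans_eq (Set.powersetCard.card_eq F).symm)
        have := hs ht
        have htw : t ≠ w := fun h => hw (h ▸ ht)
        simp only [Finset.mem_insert, Finset.mem_singleton] at this ⊢
        tauto
      by_cases hd : d ∈ (F : Finset (Fin (m + 2)))
      · by_cases hc : c ∈ (F : Finset (Fin (m + 2)))
        · by_cases hb : b ∈ (F : Finset (Fin (m + 2)))
          · refine Or.inr (Or.inr (Or.inr ⟨F, hF, ?_⟩))
            refine (Finset.eq_of_subset_of_card_le ?_ ?_).symm
            · intro t ht
              simp only [Finset.mem_insert, Finset.mem_singleton] at ht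
              rcases ht with rfl | rfl | rfl <;> assumption
            · rw [Set.powersetCard.card_eq F, Finset.card_eq_three.2 ⟨b, c, d, hbc, hbd, hcd, rfl⟩]
          · refine Or.inr (Or.inr (Or.inl ⟨F, hF, hcard a c d b ?_ hb⟩))
            refine hFQ.trans fun t ht => ?_
            simp only [Finset.mem_insert, Finset.mem_singleton] at ht ⊢
            tauto
        · refine Or.inr (Or.inl ⟨F, hF, hcard a b d c ?_ hc⟩)
          refine hFQ.trans fun t ht => ?_
          simp only [Finset.mem_insert, Finset.mem_singleton] at ht ⊢
          tauto
      · exact Or.inl ⟨F, hF, hcard a b c d hFQ hd⟩)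
  set M := compoundSub (coneMatrix m) C H
  -- The coordinate of `y` at `S`, with value 0 when `S` is not in `C`. In particular it vanishes on
  -- the degenerate sets `{0, 0, i}`.
  let Y : Finset (Fin (m + 2)) → ({T // T ∈ C} → ℚ) →ₗ[ℚ] ℚ := fun S =>
    ∑ T : {T // T ∈ C}, (if (T.1 : Finset (Fin (m + 2))) = S then (1 : ℚ) else 0) •
      LinearMap.proj T
  have hY : ∀ S y, Y S y =
      ∑ T : {T // T ∈ C}, (if (T.1 : Finset (Fin (m + 2))) = S then (1 : ℚ) else 0) * y T := by
    intro S y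
    simp only [Y, LinearMap.sum_apply, LinearMap.smul_apply, LinearMap.proj_apply, smul_eq_mul]
  have hY0 : ∀ i y, Y {0, 0, i} y = 0 := by
    intro i y
    rw [hY]
    refine Finset.sum_eq_zero fun T _ => ?_
    rw [if_neg, zero_mul]
    intro h
    have h1 := Set.powersetCard.card_eq T.1
    rw [h, Finset.insert_eq_of_mem (Finset.mem_insert_self _ _)] at h1
    have := Finset.card_le_two (a := (0 : Fin (m + 2))) (b := i)
    omega
  let sgn : Fin (m + 2) → Fin (m + 2) → ℚ := fun i j => if i < j then 1 else if j < i then -1 else 0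
  have hsgn : ∀ i j, i < j → sgn i j = 1 := fun i j h => if_pos h
  have hanti : ∀ i j, sgn i j = - sgn j i := by
    intro i j
    rcases lt_trichotomy i j with h | rfl | h
    · simp [sgn, h, h.asymm]
    · simp [sgn]
    · simp [sgn, h, h.asymm]
  -- A vector indexed by `C` is read as an alternating cochain, the value on the edge `i j` being
  -- the signed coordinate at `{0, i, j}`.
  let W : Fin (m + 2) → Fin (m + 2) → ({T // T ∈ C} → ℚ) →ₗ[ℚ] ℚ := fun i j =>
    sgn i j • Y {0, i, j}
  have hW : ∀ i j y, W i j y = sgn i j * Y {0, i, j} y := fun _ _ _ => rfl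
  have hWanti : ∀ i j y, W i j y = - W j i y := by
    intro i j y
    rw [hW, hW, hanti, Finset.pair_comm, neg_mul]
  have hW0 : ∀ i y, W i i y = 0 := fun i y => by simp [hW, sgn]
  have hMW : ∀ y, M.mulVecLin y = 0 → ∀ i j k,
      (∃ F ∈ H, (F : Finset (Fin (m + 2))) = {i, j, k}) → W i j y + W j k y + W k i y = 0 := by
    rintro y hy i j k ⟨F, hF, hFijk⟩
    obtain ⟨a, b, c, hab, hbc, hFabc, hT⟩ := exists_compound_coneMatrix F
    have h1 : W b c y - W a c y + W a b y = 0 := by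
      have := congrFun hy ⟨F, hF⟩
      rw [Matrix.mulVecLin_apply, Matrix.mulVec, dotProduct, Pi.zero_apply] at this
      rw [hW, hW, hW, hsgn _ _ hab, hsgn _ _ hbc, hsgn _ _ (hab.trans hbc), hY, hY, hY, one_mul,
        one_mul, one_mul, ← Finset.sum_sub_distrib, ← Finset.sum_add_distrib]
      refine Eq.trans ?_ this
      refine Finset.sum_congr rfl fun T _ => ?_
      have h2 : M ⟨F, hF⟩ T = _ := hT T.1 ((hC _).1 T.2)
      rw [h2]
      ring
    have hca := hWanti c a y
    have hba := hWanti b a y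
    have hcb := hWanti c b y
    have hi : i ∈ (F : Finset (Fin (m + 2))) := by simp [hFijk]
    have hj : j ∈ (F : Finset (Fin (m + 2))) := by simp [hFijk]
    have hk : k ∈ (F : Finset (Fin (m + 2))) := by simp [hFijk]
    rw [hFabc] at hi hj hk
    simp only [Finset.mem_insert, Finset.mem_singleton] at hi hj hk
    have ha0 := hW0 a y
    have hb0 := hW0 b y
    have hc0 := hW0 c y
    rcases hi with rfl | rfl | rfl <;> rcases hj with rfl | rfl | rfl <;>
      rcases hk with rfl | rfl | rfl <;> linarith
  -- The coboundary on the triangles of `R` embeds the kernel of `M` in a space of dimension at most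
  -- `m`.
  let φ : ({T // T ∈ C} → ℚ) →ₗ[ℚ] ({p // p ∈ R} → ℚ) := LinearMap.pi fun p =>
    W p.1.1 p.1.2.1 + W p.1.2.1 p.1.2.2 + W p.1.2.2 p.1.1
  have hinj : Function.Injective (φ.domRestrict (LinearMap.ker M.mulVecLin)) := by
    rw [← LinearMap.ker_eq_bot, LinearMap.ker_eq_bot']
    rintro ⟨y, hy⟩ hφ
    have hcl := hRw (fun i j => W i j y) (fun i => hW0 i y) (fun i j => hWanti i j y)
      (fun i _ j _ k _ => hMW y hy i j k) (fun p hp => congrFun hφ ⟨p, hp⟩)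
    ext T
    obtain ⟨a, b, c, hab, hbc, hTabc, -⟩ := exists_compound_coneMatrix T.1
    have ha : a = 0 := by
      have h0 := (hC _).1 T.2
      rw [hTabc] at h0
      simp only [Finset.mem_insert, Finset.mem_singleton] at h0
      rcases h0 with h | h | h
      · exact h.symm
      · exact absurd (h ▸ hab) (Fin.not_lt_zero _)
      · exact absurd (h ▸ hbc) (Fin.not_lt_zero _)
    subst ha
    -- The cochain vanishes on edges at 0, so closedness on `0 b c` leaves only its value on `b c`,
    -- the coordinate at `T`.
    have h1 := hcl 0 (Finset.mem_univ _) b (Finset.mem_univ _) c (Finset.mem_univ _)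
    simp only [hWanti c 0, hW 0, hY0, mul_zero, neg_zero, add_zero, zero_add] at h1
    rw [hW, hsgn _ _ hbc, one_mul, hY, Finset.sum_eq_single T, if_pos hTabc, one_mul] at h1
    · exact h1
    · intro T' _ hne
      rw [if_neg, zero_mul]
      exact fun h => hne (Subtype.ext (Subtype.ext (h.trans hTabc.symm)))
    · exact fun h => absurd (Finset.mem_univ _) h
  have hker : Module.finrank ℚ (LinearMap.ker M.mulVecLin) ≤ m := by
    refine (LinearMap.finrank_le_finrank_of_injective hinj).trans ?_
    rw [Module.finrank_fintype_fun_eq_card, Fintype.card_coe]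
    exact hR
  have hrn := LinearMap.finrank_range_add_finrank_ker M.mulVecLin
  rw [Module.finrank_fintype_fun_eq_card, Fintype.card_coe] at hrn
  have hcard := choose_le_card_filter_zero_mem m C hC
  -- Subtracting the kernel bound `m` from the number of columns leaves `m.choose 2`, by Pascal's
  -- rule.
  have hch : (m + 1).choose 2 = m.choose 1 + m.choose 2 := Nat.choose_succ_succ' m 1
  rw [Nat.choose_one_right] at hch
  change _ ≤ Module.finrank ℚ (LinearMap.range M.mulVecLin)
  omega

theorem mainTheorem3 (n : ℕ) (H : Finset (Set.powersetCard (Fin n) 3))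
    (hH : IsTuranHypergraph H) :
    (n - 2).choose 2 ≤
      ((lexShifting H).filter fun F : Set.powersetCard (Fin n) 3 =>
        ∃ i ∈ (F : Finset (Fin n)), (i : ℕ) = 0).card := by
  classical
  rcases lt_or_ge n 2 with hn | hn
  · rw [Nat.sub_eq_zero_of_le hn.le]
    exact Nat.zero_le _
  obtain ⟨m, rfl⟩ := Nat.exists_eq_add_of_le' hn
  have : Fintype (Set.powersetCard (Fin (m + 2)) 3) := Fintype.ofFinite _
  let C : Finset (Set.powersetCard (Fin (m + 2)) 3) :=
    Finset.univ.filter fun F => 0 ∈ (F : Finset (Fin (m + 2)))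
  have hC : ∀ F, F ∈ C ↔ 0 ∈ (F : Finset (Fin (m + 2))) := fun F => by simp [C]
  refine (choose_le_rank_coneMatrix H C hH hC).trans ((rank_compoundSub_le_generic _ _ _).trans
    (rank_le_card_filter_lexShifting H C fun F => ?_))
  rw [hC]
  constructor
  · exact fun h => ⟨0, h, rfl⟩
  · rintro ⟨i, hi, h0⟩
    rwa [show i = 0 from Fin.ext h0] at hi
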